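/- Consider a cascade of two bimodal switched systems $$\text{I}:\ \dot\xi_1=\begin{cases}f_{11}(\xi_1,t), & H_1(\xi_1)>0\\ f_{12}(\xi_1,t), & H_1(\xi_1)<0,\end{cases}\qquad \text{II}:\ \dot\xi_2=\begin{cases}f_{21}(\xi_1,\xi_2,t), & H_2(\xi_2)>0\\ f_{22}(\xi_1,\xi_2,t), & H_2(\xi_2)<0,\end{cases}$$ with $\xi_1\in\mathbb R^{n_1}$, $\xi_2\in\mathbb R^{n_2}$, $t\ge 0$, where for each $t$ the modes are continuously differentiable in the state, $H_1,H_2$ are real-valued and continuously differentiable, and $\nabla H_i\neq0$ on $\{H_i=0\}$. Solutions are understood in the sense of Filippov: they are absolutely continuous on compact intervals of $[0,\infty)$, and for almost every $t$ the derivative of each $\xi_i$ is given by the active mode of system $i$ or, if $H_i(\xi_i)=0$, is a convex combination of the two modes of system $i$. Fix any norms on $\mathbb R^{n_1}$ and $\mathbb R^{n_2}$; $\|A\|$ is the induced operator norm and $\mu(A)=\limsup_{h\to0^+}(\|I+hA\|-1)/h$ the induced matrix measure. Suppose there are constants $q_1,q_2,\tilde c_1,\tilde c_2>0$ such that, for all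 $\xi_1\in\mathbb R^{n_1}$, $\xi_2\in\mathbb R^{n_2}$ and $t\ge0$: 1) $\mu\big(\tfrac{\partial f_{21}}{\partial\xi_2}(\xi_1,\xi_2,t)\big)\le -q_1$ if $H_2(\xi_2)>0$, and $\mu\big(\tfrac{\partial f_{22}}{\partial\xi_2}(\xi_1,\xi_2,t)\big)\le -q_2$ if $H_2(\xi_2)<0$; 2) $\mu\big[(f_{21}-f_{22})(\xi_1,\xi_2,t)\,\nabla H_2(\xi_2)\big]=0$ if $H_2(\xi_2)=0$, where $\nabla H_2$ is a row vector; 3) $\big\|\tfrac{\partial f_{21}}{\partial\xi_1}(\xi_1,\xi_2,t)\big\|\le\tilde c_1$ if $H_2(\xi_2)>0$, and $\big\|\tfrac{\partial f_{22}}{\partial\xi_1}(\xi_1,\xi_2,t)\big\|\le\tilde c_2$ if $H_2(\xi_2)<0$. Suppose further that system I is contracting with rate $p>0$, in either of the following senses: (a) system I is incrementally exponentially stable with rate $p$, i.e. there is $k>0$ with $\|\xi_1(t)-\xi_1'(t)\|\le k e^{-pt}\|\xi_1(0)-\xi_1'(0)\|$ for any two solutions $\xi_1,\xi_1'$ of system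 I and all $t\ge0$; or (b) $p=\min(p_1,p_2)$ for some $p_1,p_2>0$ such that, for all $\xi_1\in\mathbb R^{n_1}$ and $t\ge 0$, $\mu(\partial f_{11}/\partial\xi_1)\le-p_1$ if $H_1(\xi_1)>0$, $\mu(\partial f_{12}/\partial\xi_1)\le-p_2$ if $H_1(\xi_1)<0$, and $\mu[(f_{11}-f_{12})\nabla H_1]=0$ if $H_1(\xi_1)=0$. Put $q=\min(q_1,q_2)$. Then the second system, driven by $\xi_1$, is incrementally exponentially stable with rate $\eta=\min(q,p)$ if $p\ne q$, and with every rate $\eta\in(0,\min(q,p))$ in all cases. Here rate $\eta$ means that there is a constant $K>0$ such that for any two solutions $(\xi_1,\xi_2)$, $(\xi_1',\xi_2')$ of the cascade and all $t\ge0$ $$\|\xi_2(t)-\xi_2'(t)\|\le e^{-\eta t}\big(\|\xi_2(0)-\xi_2'(0)\|+K\|\xi_1(0)-\xi_1'(0)\|\big).$$ -/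

import Mathlib

open Filter Topology MeasureTheory

noncomputable section

/-- The matrix measure (logarithmic norm) of a linear map, for the operator norm induced by the
norm of `E`: `μ(A) = limsup_{h → 0⁺} (‖I + h A‖ - 1) / h`. -/
def matrixMeasure {E : Type*} [NormedAddCommGroup E] [NormedSpace ℝ E] (A : E →L[ℝ] E) : ℝ :=
  limsup (fun h : ℝ => (‖ContinuousLinearMap.id ℝ E + h • A‖ - 1) / h) (𝓝[>] 0)

/-- The rank-one linear map `v ↦ (∇H(ξ) · v) a`, i.e. the matrix `a ∇H(ξ)` (column times row). -/
def colTimesGrad {E : Type*} [NormedAddCommGroup E] [NormedSpace ℝ E]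
    (a : E) (H : E → ℝ) (ξ : E) : E →L[ℝ] E :=
  (fderiv ℝ H ξ).smulRight a

/-- `{H = 0}` is a regular (continuously differentiable) switching hypersurface. -/
def IsSwitchingManifold {E : Type*} [NormedAddCommGroup E] [NormedSpace ℝ E] (H : E → ℝ) : Prop :=
  ContDiff ℝ 1 H ∧ ∀ ξ, H ξ = 0 → fderiv ℝ H ξ ≠ 0

/-- The Filippov set-valued vector field of the bimodal piecewise smooth vector field which equals
`g₁ t` on `{H > 0}` and `g₂ t` on `{H < 0}`: on the switching surface `{H = 0}` it is the set of
all convex combinations of the two modes. -/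
def filippovField {E : Type*} [NormedAddCommGroup E] [NormedSpace ℝ E]
    (g₁ g₂ : ℝ → E → E) (H : E → ℝ) (t : ℝ) (ξ : E) : Set E :=
  if 0 < H ξ then {g₁ t ξ} else if H ξ < 0 then {g₂ t ξ} else segment ℝ (g₁ t ξ) (g₂ t ξ)

/-- `x` solves the differential inclusion `x' ∈ F(t, x)` on `[0, ∞)`: it is absolutely continuous on
compact intervals and satisfies the inclusion for almost every time. -/
def IsSolution {E : Type*} [NormedAddCommGroup E] [NormedSpace ℝ E]
    (F : ℝ → E → Set E) (x : ℝ → E) : Prop :=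
  (∀ T : ℝ, 0 < T → AbsolutelyContinuousOnInterval x 0 T) ∧
    ∀ᵐ t ∂(volume : Measure ℝ), 0 < t → ∃ v ∈ F t (x t), HasDerivAt x v t

/-- `(x₁, x₂)` is a Filippov solution on `[0, ∞)` of the cascade of two bimodal switched systems
`ξ₁' = f₁σ(ξ₁, t)`, `ξ₂' = f₂σ(ξ₁, ξ₂, t)`, where system I switches on `{H₁ = 0}` and system II
switches on `{H₂ = 0}`. (The modes are continuous in the state and the two switching conditions
constrain different coordinates, so the Filippov field of the joint system is the product of
the two.) -/
def IsCascadeSolution {E₁ E₂ : Type*} [NormedAddCommGroup E₁] [NormedSpace ℝ E₁]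
    [NormedAddCommGroup E₂] [NormedSpace ℝ E₂]
    (f₁₁ f₁₂ : ℝ → E₁ → E₁) (H₁ : E₁ → ℝ) (f₂₁ f₂₂ : ℝ → E₁ → E₂ → E₂) (H₂ : E₂ → ℝ)
    (x₁ : ℝ → E₁) (x₂ : ℝ → E₂) : Prop :=
  IsSolution (filippovField f₁₁ f₁₂ H₁) x₁ ∧
    IsSolution (filippovField (fun t => f₂₁ t (x₁ t)) (fun t => f₂₂ t (x₁ t)) H₂) x₂

/-- The differential inclusion `x' ∈ F(t, x)` is (globally) incrementally exponentially stable with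
convergence rate `p`. -/
def IncrementallyExpStable {E : Type*} [NormedAddCommGroup E] [NormedSpace ℝ E]
    (F : ℝ → E → Set E) (p : ℝ) : Prop :=
  ∃ k : ℝ, 0 < k ∧ ∀ x y : ℝ → E, IsSolution F x → IsSolution F y →
    ∀ t : ℝ, 0 ≤ t → ‖x t - y t‖ ≤ k * Real.exp (-p * t) * ‖x 0 - y 0‖

/-- In a cascade, the second system is incrementally exponentially stable with convergence rate `η`
when it is driven by the first one: for any two solutions of the cascade,
`‖δξ₂(t)‖ ≤ e^{-ηt} (‖δξ₂(0)‖ + K ‖δξ₁(0)‖)`, with `K` independent of the solutions and of `t`. -/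
def DrivenIncrementallyExpStable {E₁ E₂ : Type*} [NormedAddCommGroup E₁] [NormedSpace ℝ E₁]
    [NormedAddCommGroup E₂] [NormedSpace ℝ E₂]
    (f₁₁ f₁₂ : ℝ → E₁ → E₁) (H₁ : E₁ → ℝ) (f₂₁ f₂₂ : ℝ → E₁ → E₂ → E₂) (H₂ : E₂ → ℝ)
    (η : ℝ) : Prop :=
  ∃ K : ℝ, 0 < K ∧ ∀ (x₁ y₁ : ℝ → E₁) (x₂ y₂ : ℝ → E₂),
    IsCascadeSolution f₁₁ f₁₂ H₁ f₂₁ f₂₂ H₂ x₁ x₂ →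
    IsCascadeSolution f₁₁ f₁₂ H₁ f₂₁ f₂₂ H₂ y₁ y₂ →
    ∀ t : ℝ, 0 ≤ t →
      ‖x₂ t - y₂ t‖ ≤ Real.exp (-η * t) * (‖x₂ 0 - y₂ 0‖ + K * ‖x₁ 0 - y₁ 0‖)

/-- The matrix measure conditions on a bimodal switched system with modes `g₁` (active on
`{H > 0}`) and `g₂` (active on `{H < 0}`): each mode has a Jacobian of matrix measure at most
`-c₁`, respectively `-c₂`, on its region, and `μ[(g₁ - g₂) ∇H] = 0` on the switching surface. -/
structure ContractionConditions {E : Type*} [NormedAddCommGroup E] [NormedSpace ℝ E]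
    (g₁ g₂ : ℝ → E → E) (H : E → ℝ) (c₁ c₂ : ℝ) : Prop where
  mode_one : ∀ t : ℝ, 0 ≤ t → ∀ ξ : E, 0 < H ξ → matrixMeasure (fderiv ℝ (g₁ t) ξ) ≤ -c₁
  mode_two : ∀ t : ℝ, 0 ≤ t → ∀ ξ : E, H ξ < 0 → matrixMeasure (fderiv ℝ (g₂ t) ξ) ≤ -c₂
  switching : ∀ t : ℝ, 0 ≤ t → ∀ ξ : E, H ξ = 0 →
    matrixMeasure (colTimesGrad (g₁ t ξ - g₂ t ξ) H ξ) = 0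

end

/-!
A functional `ℓ` norming the difference `δ` of two states differentiates `‖δ‖` along the flow, and
`ℓ (A δ) ≤ μ(A) ‖δ‖`. Hence the condition `μ[(g₁ - g₂) ∇H] = 0` says that whenever a segment in the
direction `δ` crosses the switching surface, `ℓ` jumps downwards along it, so that the largest value
of `ℓ` on the Filippov set decreases along the segment at rate at least `min c₁ c₂ * ‖δ‖`. If `δ` is
tangent to the surface, the same condition makes `δ` Birkhoff orthogonal to the jump `g₁ - g₂`, and
`ℓ` can be chosen to vanish on the jump. Either way the Filippov field is strongly dissipative.
Changing the driving signal moves the Filippov set of the second system by at most a constant times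
the distance of the two signals, which decays exponentially, and the Grönwall inequality concludes.
-/

section NormingFunctionals

section Seminormed

variable {E : Type*} [SeminormedAddCommGroup E] [NormedSpace ℝ E]

/-- `ℓ` is a norming functional of `δ`: a point of the dual unit ball at which `‖δ‖` is attained.
For `δ = 0` this is every functional of norm at most one. -/
structure IsNorming (ℓ : E →L[ℝ] ℝ) (δ : E) : Prop where
  norm_le_one : ‖ℓ‖ ≤ 1
  apply_self : ℓ δ = ‖δ‖

variable {ℓ : E →L[ℝ] ℝ} {δ : E}

theorem exists_isNorming (δ : E) : ∃ ℓ : E →L[ℝ] ℝ, IsNorming ℓ δ :=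
  let ⟨ℓ, hℓ, hδ⟩ := exists_dual_vector'' ℝ δ
  ⟨ℓ, hℓ, hδ⟩

theorem IsNorming.apply_le_norm (hℓ : IsNorming ℓ δ) (z : E) : ℓ z ≤ ‖z‖ := by
  simpa using (le_abs_self _).trans (ℓ.le_of_opNorm_le hℓ.norm_le_one z)

end Seminormed

variable {E : Type*} [NormedAddCommGroup E] [NormedSpace ℝ E] {ℓ : E →L[ℝ] ℝ} {δ : E}

theorem isBoundedUnder_matrixMeasure (A : E →L[ℝ] E) :
    IsBoundedUnder (· ≤ ·) (𝓝[>] 0)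
      fun h : ℝ => (‖ContinuousLinearMap.id ℝ E + h • A‖ - 1) / h := by
  refine isBoundedUnder_of_eventually_le (a := ‖A‖) ?_
  filter_upwards [self_mem_nhdsWithin] with h (hh : 0 < h)
  rw [div_le_iff₀ hh, sub_le_iff_le_add']
  calc ‖ContinuousLinearMap.id ℝ E + h • A‖
      ≤ ‖ContinuousLinearMap.id ℝ E‖ + ‖h • A‖ := norm_add_le _ _
    _ ≤ 1 + ‖A‖ * h := by
        rw [norm_smul, Real.norm_of_nonneg hh.le, mul_comm h]
        gcongr
        exact ContinuousLinearMap.norm_id_le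

theorem IsNorming.apply_le_matrixMeasure_mul (hℓ : IsNorming ℓ δ) (A : E →L[ℝ] E) :
    ℓ (A δ) ≤ matrixMeasure A * ‖δ‖ := by
  rcases eq_or_ne δ 0 with rfl | h0
  · simp
  have hδ : 0 < ‖δ‖ := norm_pos_iff.2 h0
  rw [← div_le_iff₀ hδ]
  refine le_limsup_of_frequently_le (Eventually.frequently ?_) (isBoundedUnder_matrixMeasure A)
  filter_upwards [self_mem_nhdsWithin] with h (hh : 0 < h)
  have key : ‖δ‖ + h * ℓ (A δ) ≤ ‖ContinuousLinearMap.id ℝ E + h • A‖ * ‖δ‖ :=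
    calc ‖δ‖ + h * ℓ (A δ) = ℓ ((ContinuousLinearMap.id ℝ E + h • A) δ) := by
          simp [hℓ.apply_self]
      _ ≤ ‖(ContinuousLinearMap.id ℝ E + h • A) δ‖ := hℓ.apply_le_norm _
      _ ≤ ‖ContinuousLinearMap.id ℝ E + h • A‖ * ‖δ‖ := ContinuousLinearMap.le_opNorm _ _
  rw [div_le_div_iff₀ hδ hh]
  linarith

theorem tendsto_add_smul_nhdsGT_zero (x b : E) :
    Tendsto (fun κ : ℝ => x + κ • b) (𝓝[>] 0) (𝓝 x) := by
  have h : Continuous fun κ : ℝ => x + κ • b := by fun_prop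
  simpa using (h.tendsto 0).mono_left nhdsWithin_le_nhds

section RankOne

variable {φ : E →L[ℝ] ℝ} {a : E}

theorem IsNorming.apply_mul_apply_nonpos (hℓ : IsNorming ℓ δ)
    (hμ : matrixMeasure (φ.smulRight a) ≤ 0) : φ δ * ℓ a ≤ 0 := by
  calc φ δ * ℓ a = ℓ (φ.smulRight a δ) := by simp
    _ ≤ matrixMeasure (φ.smulRight a) * ‖δ‖ := hℓ.apply_le_matrixMeasure_mul _
    _ ≤ 0 := mul_nonpos_of_nonpos_of_nonneg hμ (norm_nonneg δ)

theorem norm_le_norm_add_smul_of_apply_mul_neg (hμ : matrixMeasure (φ.smulRight a) ≤ 0) {τ : ℝ}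
    (hδ : φ δ * τ < 0) : ‖δ‖ ≤ ‖δ + τ • a‖ := by
  obtain ⟨ℓ, hℓ⟩ := exists_isNorming δ
  have hτ : 0 ≤ τ * ℓ a := by
    rcases mul_neg_iff.1 hδ with ⟨hφ, hτ⟩ | ⟨hφ, hτ⟩
    · exact mul_nonneg_of_nonpos_of_nonpos hτ.le
        (nonpos_of_mul_nonpos_right (hℓ.apply_mul_apply_nonpos hμ) hφ)
    · exact mul_nonneg hτ.le
        (nonneg_of_mul_nonpos_right (hℓ.apply_mul_apply_nonpos hμ) hφ)
  calc ‖δ‖ ≤ ℓ δ + τ * ℓ a := by linarith [hℓ.apply_self]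
    _ = ℓ (δ + τ • a) := by simp
    _ ≤ ‖δ + τ • a‖ := hℓ.apply_le_norm _

theorem norm_le_norm_add_smul_of_apply_eq_zero (hμ : matrixMeasure (φ.smulRight a) ≤ 0)
    (hφ : φ ≠ 0) (hδ : φ δ = 0) (τ : ℝ) : ‖δ‖ ≤ ‖δ + τ • a‖ := by
  rcases eq_or_ne τ 0 with rfl | hτ
  · simp
  obtain ⟨b, hb⟩ : ∃ b, φ b * τ < 0 := by
    obtain ⟨b, hb⟩ := φ.exists_ne_zero hφ
    refine ⟨-(φ b * τ) • b, ?_⟩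
    have : 0 < (φ b * τ) ^ 2 := by positivity
    simp only [map_smul, smul_eq_mul]
    linarith
  refine le_of_tendsto_of_tendsto (tendsto_add_smul_nhdsGT_zero δ b).norm
    ((tendsto_add_smul_nhdsGT_zero δ b).add_const (τ • a)).norm ?_
  filter_upwards [self_mem_nhdsWithin] with κ (hκ : 0 < κ)
  refine norm_le_norm_add_smul_of_apply_mul_neg hμ ?_
  simpa [hδ, mul_assoc] using mul_neg_of_pos_of_neg hκ hb

theorem exists_isNorming_apply_eq_zero (h : ∀ τ : ℝ, ‖δ‖ ≤ ‖δ + τ • a‖) :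
    ∃ ℓ : E →L[ℝ] ℝ, IsNorming ℓ δ ∧ ℓ a = 0 := by
  -- Hahn–Banach on the quotient by the line of `a`, where `δ` keeps its norm.
  let S : Submodule ℝ E := ℝ ∙ a
  have hS : ∀ z, ‖S.mkQL z‖ ≤ ‖z‖ := Submodule.Quotient.norm_mk_le S
  have hδ : ‖S.mkQL δ‖ = ‖δ‖ := by
    refine le_antisymm (hS δ) (le_of_forall_pos_lt_add fun ε hε => ?_)
    obtain ⟨m, hm, hmε⟩ := Submodule.Quotient.norm_mk_lt (S.mkQL δ) hε
    obtain ⟨τ, hτ⟩ := Submodule.mem_span_singleton.1 ((Submodule.Quotient.eq S).1 hm)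
    calc ‖δ‖ ≤ ‖δ + τ • a‖ := h τ
      _ = ‖m‖ := by rw [hτ, add_sub_cancel]
      _ < ‖S.mkQL δ‖ + ε := hmε
  obtain ⟨g, hg⟩ := exists_isNorming (S.mkQL δ)
  refine ⟨g.comp S.mkQL, ⟨?_, ?_⟩, ?_⟩
  · refine ContinuousLinearMap.opNorm_le_bound _ zero_le_one fun z => ?_
    exact (g.le_of_opNorm_le hg.norm_le_one _).trans (by simpa using hS z)
  · exact hg.apply_self.trans hδ
  · have ha : S.mkQL a = 0 :=
      (Submodule.Quotient.mk_eq_zero S).2 (Submodule.mem_span_singleton_self a)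
    simp [ha]

end RankOne

end NormingFunctionals

section OneSided

variable {f : ℝ → ℝ} {d s : ℝ}

theorem eventually_nhdsGT_lt_of_hasDerivAt_neg (hf : HasDerivAt f d s) (hd : d < 0) :
    ∀ᶠ u in 𝓝[>] s, f u < f s := by
  filter_upwards [(hf.tendsto_slope.eventually_lt_const hd).filter_mono (nhdsGT_le_nhdsNE s),
    self_mem_nhdsWithin] with u hu (hsu : s < u)
  exact (slope_neg_iff_of_le hsu.le).1 hu

theorem eventually_nhdsLT_lt_of_hasDerivAt_neg (hf : HasDerivAt f d s) (hd : d < 0) :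
    ∀ᶠ u in 𝓝[<] s, f s < f u := by
  filter_upwards [(hf.tendsto_slope.eventually_lt_const hd).filter_mono (nhdsLT_le_nhdsNE s),
    self_mem_nhdsWithin] with u hu (hus : u < s)
  rw [slope_comm] at hu
  exact (slope_neg_iff_of_le hus.le).1 hu

theorem antitone_of_eventually_nhdsGT_nhdsLT (hr : ∀ s, ∀ᶠ u in 𝓝[>] s, f u ≤ f s)
    (hl : ∀ s, ∀ᶠ u in 𝓝[<] s, f s ≤ f u) : Antitone f := by
  intro a b hab
  set A : Set ℝ := {s | s ∈ Set.Icc a b ∧ f s ≤ f a}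
  have haA : a ∈ A := ⟨Set.left_mem_Icc.2 hab, le_rfl⟩
  have hA : IsLUB A (sSup A) := isLUB_csSup ⟨a, haA⟩ ⟨b, fun s hs => hs.1.2⟩
  have hmem : sSup A ∈ A := by
    refine ⟨⟨hA.1 haA, hA.2 fun s hs => hs.1.2⟩, ?_⟩
    obtain ⟨l, hl, hlA⟩ := mem_nhdsLT_iff_exists_Ioo_subset.1 (hl (sSup A))
    obtain ⟨s, hs, hls, hsA⟩ := hA.exists_between hl
    rcases hsA.lt_or_eq with h | h
    · exact (hlA ⟨hls, h⟩).trans hs.2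
    · exact h ▸ hs.2
  rcases hmem.1.2.lt_or_eq with h | h
  · obtain ⟨u, hu, hsu, hub⟩ := ((hr (sSup A)).and (Ioo_mem_nhdsGT h)).exists
    have huA : u ∈ A := ⟨⟨hmem.1.1.trans hsu.le, hub.le⟩, hu.trans hmem.2⟩
    exact absurd (hA.1 huA) hsu.not_ge
  · exact h ▸ hmem.2

theorem antitone_of_forall_pos_antitone_sub_mul (h : ∀ ε > 0, Antitone fun u => f u - ε * u) :
    Antitone f := by
  intro a b hab
  have hlim : Tendsto (fun ε => f a + ε * (b - a)) (𝓝[>] 0) (𝓝 (f a)) := by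
    simpa using tendsto_add_smul_nhdsGT_zero (f a) (b - a)
  refine ge_of_tendsto hlim ?_
  filter_upwards [self_mem_nhdsWithin] with ε hε
  linarith [h ε hε hab]

end OneSided

section SwitchingSurface

variable {E : Type*} [NormedAddCommGroup E] [NormedSpace ℝ E] {H : E → ℝ}

theorem hasDerivAt_comp_add_smul {F : Type*} [NormedAddCommGroup F] [NormedSpace ℝ F] {f : E → F}
    (hf : Differentiable ℝ f) (x δ : E) (s : ℝ) :
    HasDerivAt (fun u : ℝ => f (x + u • δ)) (fderiv ℝ f (x + s • δ) δ) s := by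
  have h : HasDerivAt (fun u : ℝ => x + u • δ) δ s := by
    simpa using ((hasDerivAt_id s).smul_const δ).const_add x
  exact (hf (x + s • δ)).hasFDerivAt.comp_hasDerivAt s h

theorem nonpos_of_fderiv_neg_on_segment (hH : Differentiable ℝ H) {x y : E} (hx : H x ≤ 0)
    (h : ∀ ξ ∈ segment ℝ x y, H ξ = 0 → fderiv ℝ H ξ (y - x) < 0) : H y ≤ 0 := by
  have hd : ∀ u : ℝ, HasDerivAt (fun u : ℝ => H (AffineMap.lineMap x y u))
      (fderiv ℝ H (AffineMap.lineMap x y u) (y - x)) u := fun u =>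
    (hH _).hasFDerivAt.comp_hasDerivAt u AffineMap.hasDerivAt_lineMap
  have hle := image_le_of_deriv_right_lt_deriv_boundary (a := 0) (b := 1) (B := fun _ => 0)
    (B' := fun _ => 0) (fun u _ => (hd u).continuousAt.continuousWithinAt)
    (fun u _ => (hd u).hasDerivWithinAt) (by simpa using hx) (fun u => hasDerivAt_const u 0)
    (fun u hu => h _ (lineMap_mem_segment ℝ x y (Set.Ico_subset_Icc_self hu)))
    (Set.right_mem_Icc.2 zero_le_one)
  simpa using hle

namespace IsSwitchingManifold

theorem differentiable (hH : IsSwitchingManifold H) : Differentiable ℝ H :=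
  hH.1.differentiable one_ne_zero

theorem neg (hH : IsSwitchingManifold H) : IsSwitchingManifold (-H) :=
  ⟨hH.1.neg, fun ξ hξ => by simpa [fderiv_neg] using hH.2 ξ (neg_eq_zero.1 hξ)⟩

theorem exists_fderiv_pos (hH : IsSwitchingManifold H) {x : E} (hx : H x = 0) :
    ∃ b, 0 < fderiv ℝ H x b := by
  obtain ⟨b, hb⟩ := (fderiv ℝ H x).exists_ne_zero (hH.2 x hx)
  rcases hb.lt_or_gt with h | h
  · exact ⟨-b, by simpa using h⟩
  · exact ⟨b, h⟩

theorem eventually_pos (hH : IsSwitchingManifold H) {x b : E} (hx : H x = 0)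
    (hb : 0 < fderiv ℝ H x b) : ∀ᶠ κ : ℝ in 𝓝[>] 0, 0 < H (x + κ • b) := by
  have hd := (hasDerivAt_comp_add_smul hH.differentiable x b 0).fun_neg
  simpa [hx] using eventually_nhdsGT_lt_of_hasDerivAt_neg hd (by simpa using hb)

theorem mem_closure_pos (hH : IsSwitchingManifold H) {x : E} (hx : 0 ≤ H x) :
    x ∈ closure {ξ | 0 < H ξ} := by
  rcases hx.lt_or_eq with h | h
  · exact subset_closure h
  obtain ⟨b, hb⟩ := hH.exists_fderiv_pos h.symm
  exact mem_closure_of_tendsto (tendsto_add_smul_nhdsGT_zero x b) (hH.eventually_pos h.symm hb)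

theorem eventually_nonneg_left (hH : IsSwitchingManifold H) {x δ : E} {s : ℝ}
    (hs : H (x + s • δ) = 0) (hδ : ∀ᶠ ξ in 𝓝 (x + s • δ), H ξ = 0 → fderiv ℝ H ξ δ ≤ 0) :
    ∀ᶠ u in 𝓝[<] s, 0 ≤ H (x + u • δ) := by
  obtain ⟨b, hb⟩ := hH.exists_fderiv_pos hs
  have hcont : Continuous fun ξ => fderiv ℝ H ξ b :=
    (hH.1.continuous_fderiv one_ne_zero).clm_apply continuous_const
  have hb' : ∀ᶠ ξ in 𝓝 (x + s • δ), 0 < fderiv ℝ H ξ b :=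
    hcont.continuousAt.eventually_const_lt hb
  obtain ⟨r, hr, hball⟩ := Metric.eventually_nhds_iff_ball.1 (hδ.and hb')
  have hline : ∀ᶠ u in 𝓝 s, x + u • δ ∈ Metric.ball (x + s • δ) r :=
    ContinuousAt.preimage_mem_nhds (by fun_prop) (Metric.ball_mem_nhds _ hr)
  filter_upwards [nhdsWithin_le_nhds hline, self_mem_nhdsWithin] with u hu (hus : u < s)
  by_contra! hneg
  -- Otherwise a segment inside the ball, nearly parallel to `δ` but tilted towards `-b`, would
  -- cross the surface from `{H < 0}` to `{H > 0}`.
  have hp : ∀ᶠ κ : ℝ in 𝓝[>] 0, x + u • δ + κ • (2 : ℝ) • b ∈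
      {ξ | H ξ < 0} ∩ Metric.ball (x + s • δ) r :=
    (tendsto_add_smul_nhdsGT_zero _ _).eventually <|
      ((isOpen_lt hH.1.continuous continuous_const).inter Metric.isOpen_ball).mem_nhds ⟨hneg, hu⟩
  have hq : ∀ᶠ κ : ℝ in 𝓝[>] 0, x + s • δ + κ • b ∈ Metric.ball (x + s • δ) r :=
    (tendsto_add_smul_nhdsGT_zero _ _).eventually (Metric.ball_mem_nhds _ hr)
  obtain ⟨κ, ⟨hp0, hpr⟩, hqr, hq0, hκ : 0 < κ⟩ :=
    (hp.and (hq.and ((hH.eventually_pos hs hb).and self_mem_nhdsWithin))).exists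
  refine (nonpos_of_fderiv_neg_on_segment hH.differentiable hp0.le fun ξ hξ h0 => ?_).not_gt hq0
  obtain ⟨hξδ, hξb⟩ := hball ξ ((convex_ball _ r).segment_subset hpr hqr hξ)
  have e : x + s • δ + κ • b - (x + u • δ + κ • (2 : ℝ) • b) = (s - u) • δ - κ • b := by module
  rw [e, map_sub, map_smul, map_smul, smul_eq_mul, smul_eq_mul]
  linarith [mul_nonpos_of_nonneg_of_nonpos (sub_pos.2 hus).le (hξδ h0), mul_pos hκ hξb]

end IsSwitchingManifold

end SwitchingSurface

section SwitchedMax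

/-- The larger of the values `α x` and `β x` allowed by the sign of `θ x`: `α` is allowed where
`0 ≤ θ` and `β` where `θ ≤ 0`. For `θ = H` and `α`, `β` the images of the two modes under a
functional, this is the largest value of the functional on the Filippov set. -/
noncomputable def switchedMax {X : Type*} (θ α β : X → ℝ) (x : X) : ℝ :=
  if 0 < θ x then α x else if θ x < 0 then β x else max (α x) (β x)

section Basic

variable {X : Type*} {θ α β : X → ℝ} {x : X}

theorem switchedMax_swap (θ α β : X → ℝ) : switchedMax (-θ) β α = switchedMax θ α β := by
  ext x
  rcases lt_trichotomy (θ x) 0 with h | h | h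
  · simp [switchedMax, h, h.not_gt]
  · simp [switchedMax, h, max_comm]
  · simp [switchedMax, h, h.not_gt]

theorem switchedMax_le_iff {r : ℝ} :
    switchedMax θ α β x ≤ r ↔ (0 ≤ θ x → α x ≤ r) ∧ (θ x ≤ 0 → β x ≤ r) := by
  rcases lt_trichotomy (θ x) 0 with h | h | h
  · simp [switchedMax, h, h.le, h.not_gt, h.not_ge]
  · simp [switchedMax, h]
  · simp [switchedMax, h, h.le, h.not_ge]

theorem le_switchedMax_of_nonneg (h : 0 ≤ θ x) : α x ≤ switchedMax θ α β x :=
  (switchedMax_le_iff.1 le_rfl).1 h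

theorem le_switchedMax_of_nonpos (h : θ x ≤ 0) : β x ≤ switchedMax θ α β x :=
  (switchedMax_le_iff.1 le_rfl).2 h

theorem min_le_switchedMax (θ α β : X → ℝ) (x : X) : min (α x) (β x) ≤ switchedMax θ α β x := by
  rcases le_total 0 (θ x) with h | h
  · exact (min_le_left _ _).trans (le_switchedMax_of_nonneg h)
  · exact (min_le_right _ _).trans (le_switchedMax_of_nonpos h)

theorem switchedMax_add (θ α β γ : X → ℝ) (x : X) :
    switchedMax θ (α + γ) (β + γ) x = switchedMax θ α β x + γ x := by
  simp only [switchedMax, Pi.add_apply, max_add_add_right]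
  split_ifs <;> rfl

end Basic

variable {θ α β α' β' : ℝ → ℝ} {s : ℝ}

theorem eventually_nhdsGT_le_switchedMax (hθ : ContinuousAt θ s)
    (hα : 0 ≤ θ s → ∃ d < 0, HasDerivAt α d s) :
    ∀ᶠ u in 𝓝[>] s, 0 ≤ θ u → α u ≤ switchedMax θ α β s := by
  rcases le_or_gt 0 (θ s) with h | h
  · obtain ⟨d, hd, hα⟩ := hα h
    filter_upwards [eventually_nhdsGT_lt_of_hasDerivAt_neg hα hd] with u hu _
    exact hu.le.trans (le_switchedMax_of_nonneg h)
  · filter_upwards [nhdsWithin_le_nhds (hθ.eventually_lt_const h)] with u hu h0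
    exact absurd h0 hu.not_ge

theorem eventually_nhdsLT_le_switchedMax (hθ : ContinuousAt θ s)
    (hα : ∃ d < 0, HasDerivAt α d s) (hβ : θ s ≤ 0 → ∃ d < 0, HasDerivAt β d s)
    (hβα : θ s = 0 → β s < α s → ∀ᶠ u in 𝓝[<] s, 0 ≤ θ u) (hs : 0 ≤ θ s) :
    ∀ᶠ u in 𝓝[<] s, α s ≤ switchedMax θ α β u := by
  obtain ⟨d, hd, hα⟩ := hα
  have hα := eventually_nhdsLT_lt_of_hasDerivAt_neg hα hd
  have of_nonneg (h : ∀ᶠ u in 𝓝[<] s, 0 ≤ θ u) : ∀ᶠ u in 𝓝[<] s, α s ≤ switchedMax θ α β u := by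
    filter_upwards [hα, h] with u hu h0
    exact hu.le.trans (le_switchedMax_of_nonneg h0)
  rcases hs.lt_or_eq with h | h
  · exact of_nonneg <|
      ((hθ.eventually_const_lt h).filter_mono nhdsWithin_le_nhds).mono fun _ => le_of_lt
  rcases lt_or_ge (β s) (α s) with hlt | hle
  · exact of_nonneg (hβα h.symm hlt)
  · obtain ⟨d, hd, hβ⟩ := hβ h.ge
    filter_upwards [hα, eventually_nhdsLT_lt_of_hasDerivAt_neg hβ hd] with u hαu hβu
    exact (le_min hαu.le (hle.trans hβu.le)).trans (min_le_switchedMax θ α β u)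

theorem antitone_switchedMax_of_hasDerivAt_neg (hθ : Continuous θ)
    (hα : ∀ s, 0 ≤ θ s → ∃ d < 0, HasDerivAt α d s) (hβ : ∀ s, θ s ≤ 0 → ∃ d < 0, HasDerivAt β d s)
    (hβα : ∀ s, θ s = 0 → β s < α s → ∀ᶠ u in 𝓝[<] s, 0 ≤ θ u)
    (hαβ : ∀ s, θ s = 0 → α s < β s → ∀ᶠ u in 𝓝[<] s, θ u ≤ 0) :
    Antitone (switchedMax θ α β) := by
  refine antitone_of_eventually_nhdsGT_nhdsLT (fun s => ?_) fun s => ?_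
  · have hr := eventually_nhdsGT_le_switchedMax (α := β) (β := α) hθ.neg.continuousAt
      fun h => hβ s (neg_nonneg.1 h)
    simp only [switchedMax_swap, Pi.neg_apply, neg_nonneg] at hr
    filter_upwards [eventually_nhdsGT_le_switchedMax hθ.continuousAt (hα s), hr] with u hl hr
    exact switchedMax_le_iff.2 ⟨hl, hr⟩
  · simp only [switchedMax_le_iff, eventually_and, eventually_imp_distrib_left]
    refine ⟨fun h => eventually_nhdsLT_le_switchedMax hθ.continuousAt (hα s h) (hβ s) (hβα s) h,
      fun h => ?_⟩
    rw [← switchedMax_swap]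
    exact eventually_nhdsLT_le_switchedMax hθ.neg.continuousAt (hβ s h)
      (fun h => hα s (neg_nonpos.1 h)) (by simpa using hαβ s) (neg_nonneg.2 h)

theorem antitone_switchedMax (hθ : Continuous θ) (hα : ∀ s, HasDerivAt α (α' s) s)
    (hβ : ∀ s, HasDerivAt β (β' s) s) (hα' : ∀ s, 0 ≤ θ s → α' s ≤ 0)
    (hβ' : ∀ s, θ s ≤ 0 → β' s ≤ 0)
    (hβα : ∀ s, θ s = 0 → β s < α s → ∀ᶠ u in 𝓝[<] s, 0 ≤ θ u)
    (hαβ : ∀ s, θ s = 0 → α s < β s → ∀ᶠ u in 𝓝[<] s, θ u ≤ 0) :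
    Antitone (switchedMax θ α β) := by
  refine antitone_of_forall_pos_antitone_sub_mul fun ε hε => ?_
  have hd (s : ℝ) : HasDerivAt (fun u => -(ε * u)) (-ε) s := by
    simpa using ((hasDerivAt_id s).const_mul ε).fun_neg
  simp only [sub_eq_add_neg, ← switchedMax_add θ α β fun u => -(ε * u)]
  exact antitone_switchedMax_of_hasDerivAt_neg hθ
    (fun s h => ⟨_, by linarith [hα' s h], (hα s).add (hd s)⟩)
    (fun s h => ⟨_, by linarith [hβ' s h], (hβ s).add (hd s)⟩)
    (by simpa using hβα) (by simpa using hαβ)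

end SwitchedMax

section FilippovField

variable {E : Type*} [NormedAddCommGroup E] [NormedSpace ℝ E]
  {g₁ g₂ : ℝ → E → E} {H : E → ℝ} {c₁ c₂ t : ℝ} {ℓ : E →L[ℝ] ℝ} {x y δ v w : E}

theorem filippovField_subset_segment :
    filippovField g₁ g₂ H t x ⊆ segment ℝ (g₁ t x) (g₂ t x) := by
  unfold filippovField
  split_ifs
  · exact Set.singleton_subset_iff.2 (left_mem_segment ℝ _ _)
  · exact Set.singleton_subset_iff.2 (right_mem_segment ℝ _ _)
  · exact subset_rfl

theorem min_le_apply_of_mem_filippovField (ℓ : E →L[ℝ] ℝ) (hw : w ∈ filippovField g₁ g₂ H t x) :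
    min (ℓ (g₁ t x)) (ℓ (g₂ t x)) ≤ ℓ w :=
  (ℓ.toLinearMap.concaveOn convex_univ).ge_on_segment (Set.mem_univ _) (Set.mem_univ _)
    (filippovField_subset_segment hw)

theorem apply_le_switchedMax_of_mem_filippovField (ℓ : E →L[ℝ] ℝ)
    (hv : v ∈ filippovField g₁ g₂ H t x) : ℓ v ≤ switchedMax H (ℓ ∘ g₁ t) (ℓ ∘ g₂ t) x := by
  unfold filippovField at hv
  unfold switchedMax
  split_ifs at hv ⊢
  · exact (congrArg ℓ hv).le
  · exact (congrArg ℓ hv).le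
  · exact (ℓ.toLinearMap.convexOn convex_univ).le_on_segment (Set.mem_univ _) (Set.mem_univ _) hv

theorem switchedMax_eq_apply_of_ne_zero (ℓ : E →L[ℝ] ℝ) (hx : H x ≠ 0)
    (hw : w ∈ filippovField g₁ g₂ H t x) : switchedMax H (ℓ ∘ g₁ t) (ℓ ∘ g₂ t) x = ℓ w := by
  unfold filippovField at hw
  unfold switchedMax
  split_ifs at hw ⊢ with hpos hneg
  · exact (congrArg ℓ hw).symm
  · exact (congrArg ℓ hw).symm
  · exact absurd (le_antisymm (not_lt.1 hpos) (not_lt.1 hneg)) hx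

theorem switchedMax_le_apply_of_apply_eq (h : ℓ (g₁ t x) = ℓ (g₂ t x))
    (hw : w ∈ filippovField g₁ g₂ H t x) : switchedMax H (ℓ ∘ g₁ t) (ℓ ∘ g₂ t) x ≤ ℓ w := by
  have hmin := min_le_apply_of_mem_filippovField ℓ hw
  rw [h, min_self] at hmin
  exact switchedMax_le_iff.2 ⟨fun _ => h.trans_le hmin, fun _ => hmin⟩

namespace ContractionConditions

theorem swap (hc : ContractionConditions g₁ g₂ H c₁ c₂) :
    ContractionConditions g₂ g₁ (-H) c₂ c₁ where
  mode_one t ht ξ hξ := hc.mode_two t ht ξ (neg_pos.1 hξ)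
  mode_two t ht ξ hξ := hc.mode_one t ht ξ (neg_neg_iff_pos.1 hξ)
  switching t ht ξ hξ := by
    have e : colTimesGrad (g₂ t ξ - g₁ t ξ) (-H) ξ = colTimesGrad (g₁ t ξ - g₂ t ξ) H ξ := by
      ext z
      simp only [colTimesGrad, fderiv_neg, ContinuousLinearMap.smulRight_apply, neg_apply]
      module
    exact e ▸ hc.switching t ht ξ (neg_eq_zero.1 hξ)

theorem apply_fderiv_mode_one_le (hc : ContractionConditions g₁ g₂ H c₁ c₂)
    (hH : IsSwitchingManifold H) (ht : 0 ≤ t) (hg₁ : ContDiff ℝ 1 (g₁ t)) (hℓ : IsNorming ℓ δ)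
    (hx : 0 ≤ H x) : ℓ (fderiv ℝ (g₁ t) x δ) ≤ -c₁ * ‖δ‖ := by
  have hcont : Continuous fun ξ => ℓ (fderiv ℝ (g₁ t) ξ δ) :=
    ℓ.continuous.comp ((hg₁.continuous_fderiv one_ne_zero).clm_apply continuous_const)
  refine closure_minimal (fun ξ hξ => ?_) (isClosed_le hcont continuous_const)
    (hH.mem_closure_pos hx)
  exact (hℓ.apply_le_matrixMeasure_mul _).trans
    (mul_le_mul_of_nonneg_right (hc.mode_one t ht ξ hξ) (norm_nonneg δ))

theorem apply_fderiv_mode_two_le (hc : ContractionConditions g₁ g₂ H c₁ c₂)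
    (hH : IsSwitchingManifold H) (ht : 0 ≤ t) (hg₂ : ContDiff ℝ 1 (g₂ t)) (hℓ : IsNorming ℓ δ)
    (hx : H x ≤ 0) : ℓ (fderiv ℝ (g₂ t) x δ) ≤ -c₂ * ‖δ‖ :=
  hc.swap.apply_fderiv_mode_one_le hH.neg ht hg₂ hℓ (neg_nonneg.2 hx)

theorem fderiv_mul_apply_sub_nonpos (hc : ContractionConditions g₁ g₂ H c₁ c₂) (ht : 0 ≤ t)
    (hℓ : IsNorming ℓ δ) (hx : H x = 0) : fderiv ℝ H x δ * (ℓ (g₁ t x) - ℓ (g₂ t x)) ≤ 0 := by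
  simpa using hℓ.apply_mul_apply_nonpos (hc.switching t ht x hx).le

theorem eventually_nonneg_left (hc : ContractionConditions g₁ g₂ H c₁ c₂)
    (hH : IsSwitchingManifold H) (ht : 0 ≤ t) (hg₁ : Continuous (g₁ t)) (hg₂ : Continuous (g₂ t))
    (hℓ : IsNorming ℓ δ) {s : ℝ} (hs : H (y + s • δ) = 0)
    (hlt : ℓ (g₂ t (y + s • δ)) < ℓ (g₁ t (y + s • δ))) :
    ∀ᶠ u in 𝓝[<] s, 0 ≤ H (y + u • δ) := by
  refine hH.eventually_nonneg_left hs ?_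
  filter_upwards [(isOpen_lt (ℓ.continuous.comp hg₂) (ℓ.continuous.comp hg₁)).mem_nhds hlt]
    with ξ hξ h0
  exact nonpos_of_mul_nonpos_left (hc.fderiv_mul_apply_sub_nonpos ht hℓ h0) (sub_pos.2 hξ)

theorem antitone_switchedMax_add (hc : ContractionConditions g₁ g₂ H c₁ c₂)
    (hH : IsSwitchingManifold H) (ht : 0 ≤ t) (hg₁ : ContDiff ℝ 1 (g₁ t))
    (hg₂ : ContDiff ℝ 1 (g₂ t)) (hℓ : IsNorming ℓ δ) (y : E) :
    Antitone fun u : ℝ =>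
      switchedMax H (ℓ ∘ g₁ t) (ℓ ∘ g₂ t) (y + u • δ) + min c₁ c₂ * ‖δ‖ * u := by
  have hd {g : E → E} (hg : ContDiff ℝ 1 g) (s : ℝ) :
      HasDerivAt (fun u : ℝ => ℓ (g (y + u • δ)) + min c₁ c₂ * ‖δ‖ * u)
        (ℓ (fderiv ℝ g (y + s • δ) δ) + min c₁ c₂ * ‖δ‖) s :=
    (ℓ.hasFDerivAt.comp_hasDerivAt s
      (hasDerivAt_comp_add_smul (hg.differentiable one_ne_zero) y δ s)).add
      (by simpa using (hasDerivAt_id s).const_mul (min c₁ c₂ * ‖δ‖))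
  have hH' : Continuous fun u : ℝ => H (y + u • δ) := hH.1.continuous.comp (by fun_prop)
  have h := antitone_switchedMax hH' (hd hg₁) (hd hg₂)
    (fun s hs => by
      have := hc.apply_fderiv_mode_one_le hH ht hg₁ hℓ hs
      have := mul_le_mul_of_nonneg_right (min_le_left c₁ c₂) (norm_nonneg δ)
      linarith)
    (fun s hs => by
      have := hc.apply_fderiv_mode_two_le hH ht hg₂ hℓ hs
      have := mul_le_mul_of_nonneg_right (min_le_right c₁ c₂) (norm_nonneg δ)
      linarith)
    (fun s hs hlt => hc.eventually_nonneg_left hH ht hg₁.continuous hg₂.continuous hℓ hs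
      (lt_of_add_lt_add_right hlt))
    (fun s hs hlt => by
      simpa using hc.swap.eventually_nonneg_left hH.neg ht hg₂.continuous hg₁.continuous hℓ
        (neg_eq_zero.2 hs) (lt_of_add_lt_add_right hlt))
  convert h using 1
  ext u
  exact (switchedMax_add (fun u : ℝ => H (y + u • δ)) (fun u => ℓ (g₁ t (y + u • δ)))
    (fun u => ℓ (g₂ t (y + u • δ))) (fun u => min c₁ c₂ * ‖δ‖ * u) u).symm

theorem switchedMax_add_le_of_fderiv_pos (hc : ContractionConditions g₁ g₂ H c₁ c₂)
    (hH : IsSwitchingManifold H) (ht : 0 ≤ t) (hg₁ : ContDiff ℝ 1 (g₁ t))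
    (hg₂ : ContDiff ℝ 1 (g₂ t)) (hℓ : IsNorming ℓ δ) (hy : H y = 0) (hδ : 0 < fderiv ℝ H y δ) :
    switchedMax H (ℓ ∘ g₁ t) (ℓ ∘ g₂ t) (y + δ) + min c₁ c₂ * ‖δ‖ ≤
      min (ℓ (g₁ t y)) (ℓ (g₂ t y)) := by
  have hjump : ℓ (g₁ t y) ≤ ℓ (g₂ t y) := sub_nonpos.1 <|
    nonpos_of_mul_nonpos_right (hc.fderiv_mul_apply_sub_nonpos ht hℓ hy) hδ
  rw [min_eq_left hjump]
  have hlim : Tendsto (fun u : ℝ => ℓ (g₁ t (y + u • δ)) + min c₁ c₂ * ‖δ‖ * u) (𝓝[>] 0)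
      (𝓝 (ℓ (g₁ t y))) := by
    have hcont : Continuous fun u : ℝ => ℓ (g₁ t (y + u • δ)) + min c₁ c₂ * ‖δ‖ * u := by
      have := hg₁.continuous
      fun_prop
    simpa using (hcont.tendsto 0).mono_left nhdsWithin_le_nhds
  refine ge_of_tendsto hlim ?_
  filter_upwards [hH.eventually_pos hy hδ, Ioo_mem_nhdsGT (zero_lt_one' ℝ)] with u hu hu01
  simpa [switchedMax, hu] using hc.antitone_switchedMax_add hH ht hg₁ hg₂ hℓ y hu01.2.le

theorem switchedMax_add_le_of_fderiv_ne_zero (hc : ContractionConditions g₁ g₂ H c₁ c₂)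
    (hH : IsSwitchingManifold H) (ht : 0 ≤ t) (hg₁ : ContDiff ℝ 1 (g₁ t))
    (hg₂ : ContDiff ℝ 1 (g₂ t)) (hℓ : IsNorming ℓ δ) (hy : H y = 0) (hδ : fderiv ℝ H y δ ≠ 0) :
    switchedMax H (ℓ ∘ g₁ t) (ℓ ∘ g₂ t) (y + δ) + min c₁ c₂ * ‖δ‖ ≤
      min (ℓ (g₁ t y)) (ℓ (g₂ t y)) := by
  rcases hδ.lt_or_gt with hneg | hpos
  · have := hc.swap.switchedMax_add_le_of_fderiv_pos hH.neg ht hg₂ hg₁ hℓ (neg_eq_zero.2 hy)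
      (by simpa [fderiv_neg] using hneg)
    rwa [switchedMax_swap, min_comm c₂, min_comm (ℓ _)] at this
  · exact hc.switchedMax_add_le_of_fderiv_pos hH ht hg₁ hg₂ hℓ hy hpos

theorem exists_isNorming_switchedMax_add_le (hc : ContractionConditions g₁ g₂ H c₁ c₂)
    (hH : IsSwitchingManifold H) (ht : 0 ≤ t) (hg₁ : ContDiff ℝ 1 (g₁ t))
    (hg₂ : ContDiff ℝ 1 (g₂ t)) (hw : w ∈ filippovField g₁ g₂ H t y) (δ : E) :
    ∃ ℓ : E →L[ℝ] ℝ, IsNorming ℓ δ ∧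
      switchedMax H (ℓ ∘ g₁ t) (ℓ ∘ g₂ t) (y + δ) + min c₁ c₂ * ‖δ‖ ≤ ℓ w := by
  have of_le {ℓ : E →L[ℝ] ℝ} (hℓ : IsNorming ℓ δ)
      (hle : switchedMax H (ℓ ∘ g₁ t) (ℓ ∘ g₂ t) y ≤ ℓ w) :
      switchedMax H (ℓ ∘ g₁ t) (ℓ ∘ g₂ t) (y + δ) + min c₁ c₂ * ‖δ‖ ≤ ℓ w := by
    have hanti := hc.antitone_switchedMax_add hH ht hg₁ hg₂ hℓ y zero_le_one
    simp only [one_smul, zero_smul, add_zero, mul_one, mul_zero] at hanti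
    exact hanti.trans hle
  obtain ⟨ℓ, hℓ⟩ := exists_isNorming δ
  by_cases hy : H y = 0
  · by_cases hδ : fderiv ℝ H y δ = 0
    · obtain ⟨ℓ', hℓ', ha⟩ := exists_isNorming_apply_eq_zero
        (norm_le_norm_add_smul_of_apply_eq_zero (hc.switching t ht y hy).le (hH.2 y hy) hδ)
      rw [map_sub, sub_eq_zero] at ha
      exact ⟨ℓ', hℓ', of_le hℓ' (switchedMax_le_apply_of_apply_eq ha hw)⟩
    · exact ⟨ℓ, hℓ, (hc.switchedMax_add_le_of_fderiv_ne_zero hH ht hg₁ hg₂ hℓ hy hδ).trans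
        (min_le_apply_of_mem_filippovField ℓ hw)⟩
  · exact ⟨ℓ, hℓ, of_le hℓ (switchedMax_eq_apply_of_ne_zero ℓ hy hw).le⟩

end ContractionConditions

end FilippovField

section Gronwall

theorem absolutelyContinuousOnInterval_norm {E : Type*} [SeminormedAddCommGroup E] {z : ℝ → E}
    {a b : ℝ} (hz : AbsolutelyContinuousOnInterval z a b) :
    AbsolutelyContinuousOnInterval (fun t => ‖z t‖) a b :=
  squeeze_zero (fun _ => Finset.sum_nonneg fun _ _ => dist_nonneg)
    (fun _ => Finset.sum_le_sum fun _ _ =>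
      (dist_norm_norm_le _ _).trans_eq (dist_eq_norm _ _).symm) hz

variable {r h : ℝ → ℝ} {a b q : ℝ}

theorem sub_le_integral_of_ae_deriv_le (hab : a ≤ b) (hr : AbsolutelyContinuousOnInterval r a b)
    (hh : IntervalIntegrable h volume a b) (hle : ∀ᵐ t, t ∈ Set.Ioc a b → deriv r t ≤ h t) :
    r b - r a ≤ ∫ t in a..b, h t := by
  rw [← hr.integral_deriv_eq_sub]
  simp only [intervalIntegral.integral_of_le hab]
  exact setIntegral_mono_ae_restrict hr.intervalIntegrable_deriv.1 hh.1
    ((ae_restrict_iff' measurableSet_Ioc).2 hle)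

theorem exp_mul_le_add_integral_of_ae_deriv_le (hab : a ≤ b)
    (hr : AbsolutelyContinuousOnInterval r a b) (hh : IntervalIntegrable h volume a b)
    (hle : ∀ᵐ t, t ∈ Set.Ioc a b → deriv r t ≤ -q * r t + h t) :
    Real.exp (q * b) * r b ≤ Real.exp (q * a) * r a + ∫ t in a..b, Real.exp (q * t) * h t := by
  rw [← sub_le_iff_le_add']
  have hexp : AbsolutelyContinuousOnInterval (fun t => Real.exp (q * t)) a b :=
    ContDiffOn.absolutelyContinuousOnInterval (by fun_prop)
  refine sub_le_integral_of_ae_deriv_le hab (hexp.fun_mul hr)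
    (hh.continuousOn_mul (by fun_prop)) ?_
  filter_upwards [hle, hr.ae_differentiableAt] with t ht hd hmem
  have hr' : HasDerivAt r (deriv r t) t :=
    (hd (Set.Ioc_subset_Icc_self.trans Set.Icc_subset_uIcc hmem)).hasDerivAt
  have he : HasDerivAt (fun t => Real.exp (q * t)) (Real.exp (q * t) * q) t :=
    HasDerivAt.exp (by simpa using (hasDerivAt_id t).const_mul q)
  calc deriv (fun t => Real.exp (q * t) * r t) t
      = Real.exp (q * t) * (q * r t + deriv r t) := by rw [(he.fun_mul hr').deriv]; ring
    _ ≤ Real.exp (q * t) * h t := by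
        gcongr
        linarith [ht hmem]

end Gronwall

section Dissipativity

variable {E : Type*} [NormedAddCommGroup E] [NormedSpace ℝ E]

theorem IsNorming.hasDerivAt_norm_eq {z : ℝ → E} {u : E} {t d : ℝ} {ℓ : E →L[ℝ] ℝ}
    (hℓ : IsNorming ℓ (z t)) (hz : HasDerivAt z u t) (hn : HasDerivAt (fun s => ‖z s‖) d t) :
    d = ℓ u := by
  have hd : HasDerivAt (fun s => ‖z s‖ - ℓ (z s)) (d - ℓ u) t :=
    hn.sub (ℓ.hasFDerivAt.comp_hasDerivAt t hz)
  have hmin : IsLocalMin (fun s => ‖z s‖ - ℓ (z s)) t := Eventually.of_forall fun s => by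
    simpa [hℓ.apply_self] using hℓ.apply_le_norm (z s)
  exact sub_eq_zero.1 (hmin.hasDerivAt_eq_zero hd)

/-- The set-valued map `Φ` satisfies the one-sided Lipschitz (strong dissipativity) condition with
constant `-q`: any two of its values are contracted at rate `q` in the direction of the difference
of their base points, as measured by some norming functional of that difference. -/
def IsStronglyDissipative (Φ : E → Set E) (q : ℝ) : Prop :=
  ∀ x y v w, v ∈ Φ x → w ∈ Φ y → ∃ ℓ : E →L[ℝ] ℝ, IsNorming ℓ (x - y) ∧ ℓ (v - w) ≤ -q * ‖x - y‖

theorem ContractionConditions.isStronglyDissipative {g₁ g₂ : ℝ → E → E} {H : E → ℝ} {c₁ c₂ t : ℝ}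
    (hc : ContractionConditions g₁ g₂ H c₁ c₂) (hH : IsSwitchingManifold H) (ht : 0 ≤ t)
    (hg₁ : ContDiff ℝ 1 (g₁ t)) (hg₂ : ContDiff ℝ 1 (g₂ t)) :
    IsStronglyDissipative (filippovField g₁ g₂ H t) (min c₁ c₂) := by
  intro x y v w hv hw
  obtain ⟨ℓ, hℓ, hle⟩ := hc.exists_isNorming_switchedMax_add_le hH ht hg₁ hg₂ hw (x - y)
  rw [add_sub_cancel] at hle
  refine ⟨ℓ, hℓ, ?_⟩
  rw [map_sub]
  linarith [apply_le_switchedMax_of_mem_filippovField ℓ hv]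

variable {Φ : E → Set E} {F G : ℝ → E → Set E} {x y : ℝ → E} {v w w' : E} {b : ℝ → ℝ}
  {c d q t : ℝ}

theorem IsStronglyDissipative.deriv_norm_sub_le (hΦ : IsStronglyDissipative Φ q)
    (hx : HasDerivAt x v t) (hy : HasDerivAt y w t)
    (hd : HasDerivAt (fun s => ‖x s - y s‖) d t) (hv : v ∈ Φ (x t)) (hw' : w' ∈ Φ (y t))
    (hww' : ‖w' - w‖ ≤ c) : d ≤ -q * ‖x t - y t‖ + c := by
  obtain ⟨ℓ, hℓ, hle⟩ := hΦ _ _ _ _ hv hw'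
  calc d = ℓ (v - w) := hℓ.hasDerivAt_norm_eq (hx.sub hy) hd
    _ = ℓ (v - w') + ℓ (w' - w) := by rw [← map_add, sub_add_sub_cancel]
    _ ≤ -q * ‖x t - y t‖ + c := add_le_add hle ((hℓ.apply_le_norm _).trans hww')

theorem exp_mul_norm_sub_le_of_isStronglyDissipative
    (hF : ∀ t, 0 < t → IsStronglyDissipative (F t) q) (hx : IsSolution F x) (hy : IsSolution G y)
    (hb : Continuous b) (hG : ∀ t, 0 < t → ∀ w ∈ G t (y t), ∃ w' ∈ F t (y t), ‖w' - w‖ ≤ b t)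
    {T : ℝ} (hT : 0 ≤ T) :
    Real.exp (q * T) * ‖x T - y T‖ ≤ ‖x 0 - y 0‖ + ∫ t in 0..T, Real.exp (q * t) * b t := by
  rcases hT.eq_or_lt with rfl | hT
  · simp
  have hr : AbsolutelyContinuousOnInterval (fun t => ‖x t - y t‖) 0 T :=
    absolutelyContinuousOnInterval_norm ((hx.1 T hT).fun_sub (hy.1 T hT))
  have h := exp_mul_le_add_integral_of_ae_deriv_le (q := q) hT.le hr
    (hb.intervalIntegrable 0 T) <| by
      filter_upwards [hx.2, hy.2, hr.ae_differentiableAt] with t hxt hyt hd hmem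
      obtain ⟨v, hv, hxv⟩ := hxt hmem.1
      obtain ⟨w, hw, hyw⟩ := hyt hmem.1
      obtain ⟨w', hw', hww'⟩ := hG t hmem.1 w hw
      exact (hF t hmem.1).deriv_norm_sub_le hxv hyw
        (hd (Set.Ioc_subset_Icc_self.trans Set.Icc_subset_uIcc hmem)).hasDerivAt hv hw' hww'
  simpa using h

end Dissipativity

section ExponentialRates

variable {p q T : ℝ}

theorem integral_exp_mul_of_ne_zero (hq : q ≠ 0) :
    ∫ t in 0..T, Real.exp (q * t) = (Real.exp (q * T) - 1) / q := by
  simp [intervalIntegral.integral_comp_mul_left, integral_exp, hq, div_eq_inv_mul]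

theorem exp_sub_exp_div_le (hpq : p ≠ q) (hT : 0 ≤ T) :
    (Real.exp (-p * T) - Real.exp (-q * T)) / (q - p) ≤
      Real.exp (-min q p * T) / |q - p| := by
  have hq : Real.exp (-q * T) ≤ Real.exp (-min q p * T) := by
    gcongr
    exact min_le_left q p
  have hp : Real.exp (-p * T) ≤ Real.exp (-min q p * T) := by
    gcongr
    exact min_le_right q p
  calc (Real.exp (-p * T) - Real.exp (-q * T)) / (q - p)
      ≤ |Real.exp (-p * T) - Real.exp (-q * T)| / |q - p| := by
        rw [← abs_div]
        exact le_abs_self _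
    _ ≤ Real.exp (-min q p * T) / |q - p| := by
        gcongr
        exact abs_sub_le_of_nonneg_of_le (Real.exp_pos _).le hp (Real.exp_pos _).le hq

theorem le_exp_mul_of_exp_mul_le_add_integral {r r₀ B : ℝ} (hpq : p ≠ q) (hT : 0 ≤ T)
    (hr₀ : 0 ≤ r₀) (hB : 0 ≤ B)
    (h : Real.exp (q * T) * r ≤ r₀ + ∫ t in 0..T, Real.exp (q * t) * (B * Real.exp (-p * t))) :
    r ≤ Real.exp (-min q p * T) * (r₀ + B / |q - p|) := by
  have hint : ∫ t in 0..T, Real.exp (q * t) * (B * Real.exp (-p * t)) =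
      B * ((Real.exp ((q - p) * T) - 1) / (q - p)) := by
    rw [← integral_exp_mul_of_ne_zero (sub_ne_zero.2 hpq.symm),
      ← intervalIntegral.integral_const_mul]
    congr with t
    rw [mul_left_comm, ← Real.exp_add]
    ring_nf
  rw [hint] at h
  have hexp (c : ℝ) : Real.exp (-q * T) * Real.exp (c * T) = Real.exp ((c - q) * T) := by
    rw [← Real.exp_add]
    ring_nf
  calc r = Real.exp (-q * T) * (Real.exp (q * T) * r) := by
        rw [← mul_assoc, hexp, sub_self, zero_mul, Real.exp_zero, one_mul]
    _ ≤ Real.exp (-q * T) * (r₀ + B * ((Real.exp ((q - p) * T) - 1) / (q - p))) := by gcongr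
    _ = Real.exp (-q * T) * r₀ +
        B * ((Real.exp (-q * T) * Real.exp ((q - p) * T) - Real.exp (-q * T)) / (q - p)) := by ring
    _ = Real.exp (-q * T) * r₀ +
        B * ((Real.exp (-p * T) - Real.exp (-q * T)) / (q - p)) := by
        rw [hexp, sub_sub_cancel_left]
    _ ≤ Real.exp (-min q p * T) * r₀ + B * (Real.exp (-min q p * T) / |q - p|) := by
        refine add_le_add ?_ (mul_le_mul_of_nonneg_left (exp_sub_exp_div_le hpq hT) hB)
        gcongr
        exact min_le_left q p
    _ = Real.exp (-min q p * T) * (r₀ + B / |q - p|) := by ring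

end ExponentialRates

section Cascade

section SingleSystem

variable {E : Type*} [NormedAddCommGroup E] [NormedSpace ℝ E]

theorem incrementallyExpStable_of_isStronglyDissipative {F : ℝ → E → Set E} {q : ℝ}
    (hF : ∀ t, 0 < t → IsStronglyDissipative (F t) q) : IncrementallyExpStable F q := by
  refine ⟨1, one_pos, fun x y hx hy t ht => ?_⟩
  have h := exp_mul_norm_sub_le_of_isStronglyDissipative (b := 0) hF hx hy continuous_zero
    (fun s _ w hw => ⟨w, hw, by simp⟩) ht
  simp only [Pi.zero_apply, mul_zero, intervalIntegral.integral_zero, add_zero] at h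
  rw [one_mul, neg_mul, Real.exp_neg]
  exact (le_inv_mul_iff₀ (Real.exp_pos _)).2 h

theorem ContractionConditions.incrementallyExpStable {g₁ g₂ : ℝ → E → E} {H : E → ℝ} {c₁ c₂ : ℝ}
    (hc : ContractionConditions g₁ g₂ H c₁ c₂) (hH : IsSwitchingManifold H)
    (hg₁ : ∀ t : ℝ, 0 ≤ t → ContDiff ℝ 1 (g₁ t)) (hg₂ : ∀ t : ℝ, 0 ≤ t → ContDiff ℝ 1 (g₂ t)) :
    IncrementallyExpStable (filippovField g₁ g₂ H) (min c₁ c₂) :=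
  incrementallyExpStable_of_isStronglyDissipative fun t ht =>
    hc.isStronglyDissipative hH ht.le (hg₁ t ht.le) (hg₂ t ht.le)

theorem IncrementallyExpStable.mono {F : ℝ → E → Set E} {p η : ℝ}
    (h : IncrementallyExpStable F p) (hη : η ≤ p) : IncrementallyExpStable F η := by
  obtain ⟨k, hk, h⟩ := h
  refine ⟨k, hk, fun x y hx hy t ht => (h x y hx hy t ht).trans ?_⟩
  gcongr

theorem exists_mem_filippovField_norm_sub_le {g₁ g₂ g₁' g₂' : ℝ → E → E} {H : E → ℝ} {t c : ℝ}
    {ξ w : E} (h₁ : 0 ≤ H ξ → ‖g₁' t ξ - g₁ t ξ‖ ≤ c) (h₂ : H ξ ≤ 0 → ‖g₂' t ξ - g₂ t ξ‖ ≤ c)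
    (hw : w ∈ filippovField g₁ g₂ H t ξ) :
    ∃ w' ∈ filippovField g₁' g₂' H t ξ, ‖w' - w‖ ≤ c := by
  unfold filippovField at hw ⊢
  split_ifs at hw ⊢ with hpos hneg
  · exact ⟨_, rfl, (Set.mem_singleton_iff.1 hw) ▸ h₁ hpos.le⟩
  · exact ⟨_, rfl, (Set.mem_singleton_iff.1 hw) ▸ h₂ hneg.le⟩
  · obtain ⟨r, s, hr, hs, hrs, rfl⟩ := hw
    refine ⟨_, ⟨r, s, hr, hs, hrs, rfl⟩, ?_⟩
    have hmem := convex_closedBall (0 : E) c (mem_closedBall_zero_iff.2 (h₁ (not_lt.1 hneg)))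
      (mem_closedBall_zero_iff.2 (h₂ (not_lt.1 hpos))) hr hs hrs
    rw [mem_closedBall_zero_iff] at hmem
    convert hmem using 1
    exact congrArg norm (by module)

end SingleSystem

variable {E₁ E₂ : Type*} [NormedAddCommGroup E₁] [NormedSpace ℝ E₁]
  [NormedAddCommGroup E₂] [NormedSpace ℝ E₂]

theorem norm_sub_le_of_fderiv_le_on_pos {f : E₁ → E₂ → E₂} {H : E₂ → ℝ}
    (hH : IsSwitchingManifold H) (hf : ContDiff ℝ 1 (fun ξ : E₁ × E₂ => f ξ.1 ξ.2)) {c : ℝ}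
    (hJ : ∀ ξ₁ ξ₂, 0 < H ξ₂ → ‖fderiv ℝ (fun ξ => f ξ ξ₂) ξ₁‖ ≤ c) (a b : E₁) {ξ₂ : E₂}
    (hξ : 0 ≤ H ξ₂) : ‖f a ξ₂ - f b ξ₂‖ ≤ c * ‖a - b‖ := by
  have hcont (a : E₁) : Continuous (f a) := hf.continuous.comp (Continuous.prodMk_right a)
  refine closure_minimal (fun ξ hξ => ?_)
    (isClosed_le ((hcont a).sub (hcont b)).norm continuous_const) (hH.mem_closure_pos hξ)
  have hd : Differentiable ℝ fun ζ => f ζ ξ :=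
    (hf.comp (contDiff_prodMk_left ξ)).differentiable one_ne_zero
  exact convex_univ.norm_image_sub_le_of_norm_fderiv_le (fun ζ _ => hd ζ)
    (fun ζ _ => hJ ζ ξ hξ) (Set.mem_univ b) (Set.mem_univ a)

theorem exists_mem_filippovField_norm_sub_le_of_fderiv_le {f₁ f₂ : ℝ → E₁ → E₂ → E₂} {H : E₂ → ℝ}
    {t c₁ c₂ : ℝ} (hH : IsSwitchingManifold H)
    (hf₁ : ContDiff ℝ 1 (fun ξ : E₁ × E₂ => f₁ t ξ.1 ξ.2))
    (hf₂ : ContDiff ℝ 1 (fun ξ : E₁ × E₂ => f₂ t ξ.1 ξ.2))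
    (hJ₁ : ∀ ξ₁ ξ₂, 0 < H ξ₂ → ‖fderiv ℝ (fun ξ => f₁ t ξ ξ₂) ξ₁‖ ≤ c₁)
    (hJ₂ : ∀ ξ₁ ξ₂, H ξ₂ < 0 → ‖fderiv ℝ (fun ξ => f₂ t ξ ξ₂) ξ₁‖ ≤ c₂) (x₁ y₁ : ℝ → E₁) {ξ w : E₂}
    (hw : w ∈ filippovField (fun t => f₁ t (y₁ t)) (fun t => f₂ t (y₁ t)) H t ξ) :
    ∃ w' ∈ filippovField (fun t => f₁ t (x₁ t)) (fun t => f₂ t (x₁ t)) H t ξ,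
      ‖w' - w‖ ≤ max c₁ c₂ * ‖x₁ t - y₁ t‖ := by
  refine exists_mem_filippovField_norm_sub_le (fun h => ?_) (fun h => ?_) hw
  · refine (norm_sub_le_of_fderiv_le_on_pos hH hf₁ hJ₁ _ _ h).trans ?_
    gcongr
    exact le_max_left _ _
  · refine (norm_sub_le_of_fderiv_le_on_pos hH.neg hf₂
      (fun ξ₁ ξ₂ h => hJ₂ ξ₁ ξ₂ (neg_pos.1 h)) _ _ (neg_nonneg.2 h)).trans ?_
    gcongr
    exact le_max_right _ _

theorem drivenIncrementallyExpStable_of_ne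
    {f₁₁ f₁₂ : ℝ → E₁ → E₁} {H₁ : E₁ → ℝ} {f₂₁ f₂₂ : ℝ → E₁ → E₂ → E₂} {H₂ : E₂ → ℝ}
    (hH₂ : IsSwitchingManifold H₂)
    (hf₂₁ : ∀ t : ℝ, 0 ≤ t → ContDiff ℝ 1 (fun ξ : E₁ × E₂ => f₂₁ t ξ.1 ξ.2))
    (hf₂₂ : ∀ t : ℝ, 0 ≤ t → ContDiff ℝ 1 (fun ξ : E₁ × E₂ => f₂₂ t ξ.1 ξ.2))
    {q₁ q₂ c₁ c₂ : ℝ}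
    (hII : ∀ ξ₁ : E₁,
      ContractionConditions (fun t => f₂₁ t ξ₁) (fun t => f₂₂ t ξ₁) H₂ q₁ q₂)
    (hJ₁ : ∀ t : ℝ, 0 ≤ t → ∀ (ξ₁ : E₁) (ξ₂ : E₂), 0 < H₂ ξ₂ →
      ‖fderiv ℝ (fun ξ : E₁ => f₂₁ t ξ ξ₂) ξ₁‖ ≤ c₁)
    (hJ₂ : ∀ t : ℝ, 0 ≤ t → ∀ (ξ₁ : E₁) (ξ₂ : E₂), H₂ ξ₂ < 0 →
      ‖fderiv ℝ (fun ξ : E₁ => f₂₂ t ξ ξ₂) ξ₁‖ ≤ c₂)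
    {p : ℝ} (hI : IncrementallyExpStable (filippovField f₁₁ f₁₂ H₁) p) (hp : p ≠ min q₁ q₂) :
    DrivenIncrementallyExpStable f₁₁ f₁₂ H₁ f₂₁ f₂₂ H₂ (min (min q₁ q₂) p) := by
  obtain ⟨k, hk, hI⟩ := hI
  set C := max (max c₁ c₂) 1
  have : 0 < C := lt_max_of_lt_right one_pos
  have : 0 < |min q₁ q₂ - p| := abs_pos.2 (sub_ne_zero.2 hp.symm)
  refine ⟨C * k / |min q₁ q₂ - p|, by positivity, fun x₁ y₁ x₂ y₂ hx hy T hT => ?_⟩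
  have hdiss (t : ℝ) (ht : 0 < t) : IsStronglyDissipative
      (filippovField (fun t => f₂₁ t (x₁ t)) (fun t => f₂₂ t (x₁ t)) H₂ t) (min q₁ q₂) :=
    (hII (x₁ t)).isStronglyDissipative hH₂ ht.le
      ((hf₂₁ t ht.le).comp (contDiff_prodMk_right (x₁ t)))
      ((hf₂₂ t ht.le).comp (contDiff_prodMk_right (x₁ t)))
  have hgap (t : ℝ) (ht : 0 < t) :
      max c₁ c₂ * ‖x₁ t - y₁ t‖ ≤ C * k * ‖x₁ 0 - y₁ 0‖ * Real.exp (-p * t) :=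
    calc max c₁ c₂ * ‖x₁ t - y₁ t‖ ≤ C * (k * Real.exp (-p * t) * ‖x₁ 0 - y₁ 0‖) := by
          gcongr
          · exact le_max_left _ _
          · exact hI x₁ y₁ hx.1 hy.1 t ht.le
      _ = C * k * ‖x₁ 0 - y₁ 0‖ * Real.exp (-p * t) := by ring
  have h := exp_mul_norm_sub_le_of_isStronglyDissipative hdiss hx.2 hy.2
    (b := fun t => C * k * ‖x₁ 0 - y₁ 0‖ * Real.exp (-p * t)) (by fun_prop) (fun t ht w hw =>
      (exists_mem_filippovField_norm_sub_le_of_fderiv_le hH₂ (hf₂₁ t ht.le) (hf₂₂ t ht.le)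
        (hJ₁ t ht.le) (hJ₂ t ht.le) x₁ y₁ hw).imp fun _ h => ⟨h.1, h.2.trans (hgap t ht)⟩) hT
  exact (le_exp_mul_of_exp_mul_le_add_integral hp hT (norm_nonneg _) (by positivity) h).trans_eq
    (by ring)

end Cascade

theorem theorem2_general
    {E₁ E₂ : Type*}
    [NormedAddCommGroup E₁] [NormedSpace ℝ E₁]
    [NormedAddCommGroup E₂] [NormedSpace ℝ E₂]
    (f₁₁ f₁₂ : ℝ → E₁ → E₁) (H₁ : E₁ → ℝ)
    (f₂₁ f₂₂ : ℝ → E₁ → E₂ → E₂) (H₂ : E₂ → ℝ)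
    (hH₁ : IsSwitchingManifold H₁) (hH₂ : IsSwitchingManifold H₂)
    (hf₁₁ : ∀ t : ℝ, 0 ≤ t → ContDiff ℝ 1 (f₁₁ t))
    (hf₁₂ : ∀ t : ℝ, 0 ≤ t → ContDiff ℝ 1 (f₁₂ t))
    (hf₂₁ : ∀ t : ℝ, 0 ≤ t → ContDiff ℝ 1 (fun ξ : E₁ × E₂ => f₂₁ t ξ.1 ξ.2))
    (hf₂₂ : ∀ t : ℝ, 0 ≤ t → ContDiff ℝ 1 (fun ξ : E₁ × E₂ => f₂₂ t ξ.1 ξ.2))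
    (q₁ q₂ c₁ c₂ : ℝ)
    (hII : ∀ ξ₁ : E₁,
      ContractionConditions (fun t => f₂₁ t ξ₁) (fun t => f₂₂ t ξ₁) H₂ q₁ q₂)
    (hJ₁ : ∀ t : ℝ, 0 ≤ t → ∀ (ξ₁ : E₁) (ξ₂ : E₂), 0 < H₂ ξ₂ →
      ‖fderiv ℝ (fun ξ : E₁ => f₂₁ t ξ ξ₂) ξ₁‖ ≤ c₁)
    (hJ₂ : ∀ t : ℝ, 0 ≤ t → ∀ (ξ₁ : E₁) (ξ₂ : E₂), H₂ ξ₂ < 0 →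
      ‖fderiv ℝ (fun ξ : E₁ => f₂₂ t ξ ξ₂) ξ₁‖ ≤ c₂) :
    (∀ p : ℝ, IncrementallyExpStable (filippovField f₁₁ f₁₂ H₁) p →
      (p ≠ min q₁ q₂ →
        DrivenIncrementallyExpStable f₁₁ f₁₂ H₁ f₂₁ f₂₂ H₂ (min (min q₁ q₂) p)) ∧
      ∀ η : ℝ, η < min (min q₁ q₂) p →
        DrivenIncrementallyExpStable f₁₁ f₁₂ H₁ f₂₁ f₂₂ H₂ η) ∧
    (∀ p₁ p₂ : ℝ, ContractionConditions f₁₁ f₁₂ H₁ p₁ p₂ →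
      (min p₁ p₂ ≠ min q₁ q₂ →
        DrivenIncrementallyExpStable f₁₁ f₁₂ H₁ f₂₁ f₂₂ H₂
          (min (min q₁ q₂) (min p₁ p₂))) ∧
      ∀ η : ℝ, η < min (min q₁ q₂) (min p₁ p₂) →
        DrivenIncrementallyExpStable f₁₁ f₁₂ H₁ f₂₁ f₂₂ H₂ η) := by
  have main (p : ℝ) (hI : IncrementallyExpStable (filippovField f₁₁ f₁₂ H₁) p) :
      (p ≠ min q₁ q₂ →
        DrivenIncrementallyExpStable f₁₁ f₁₂ H₁ f₂₁ f₂₂ H₂ (min (min q₁ q₂) p)) ∧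
      ∀ η : ℝ, η < min (min q₁ q₂) p →
        DrivenIncrementallyExpStable f₁₁ f₁₂ H₁ f₂₁ f₂₂ H₂ η := by
    refine ⟨drivenIncrementallyExpStable_of_ne hH₂ hf₂₁ hf₂₂ hII hJ₁ hJ₂ hI, fun η hη => ?_⟩
    obtain ⟨hηq, hηp⟩ := lt_min_iff.1 hη
    have h := drivenIncrementallyExpStable_of_ne hH₂ hf₂₁ hf₂₂ hII hJ₁ hJ₂ (hI.mono hηp.le) hηq.ne
    rwa [min_eq_right hηq.le] at h
  exact ⟨main, fun p₁ p₂ hI => main _ (hI.incrementallyExpStable hH₁ hf₁₁ hf₁₂)⟩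

theorem theorem2
    {E₁ E₂ : Type*}
    [NormedAddCommGroup E₁] [NormedSpace ℝ E₁] [FiniteDimensional ℝ E₁]
    [NormedAddCommGroup E₂] [NormedSpace ℝ E₂] [FiniteDimensional ℝ E₂]
    (f₁₁ f₁₂ : ℝ → E₁ → E₁) (H₁ : E₁ → ℝ)
    (f₂₁ f₂₂ : ℝ → E₁ → E₂ → E₂) (H₂ : E₂ → ℝ)
    (hH₁ : IsSwitchingManifold H₁) (hH₂ : IsSwitchingManifold H₂)
    (hf₁₁ : ∀ t : ℝ, 0 ≤ t → ContDiff ℝ 1 (f₁₁ t))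
    (hf₁₂ : ∀ t : ℝ, 0 ≤ t → ContDiff ℝ 1 (f₁₂ t))
    (hf₂₁ : ∀ t : ℝ, 0 ≤ t → ContDiff ℝ 1 (fun ξ : E₁ × E₂ => f₂₁ t ξ.1 ξ.2))
    (hf₂₂ : ∀ t : ℝ, 0 ≤ t → ContDiff ℝ 1 (fun ξ : E₁ × E₂ => f₂₂ t ξ.1 ξ.2))
    (q₁ q₂ c₁ c₂ : ℝ) (hq₁ : 0 < q₁) (hq₂ : 0 < q₂) (hc₁ : 0 < c₁) (hc₂ : 0 < c₂)
    (hII : ∀ ξ₁ : E₁,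
      ContractionConditions (fun t => f₂₁ t ξ₁) (fun t => f₂₂ t ξ₁) H₂ q₁ q₂)
    (hJ₁ : ∀ t : ℝ, 0 ≤ t → ∀ (ξ₁ : E₁) (ξ₂ : E₂), 0 < H₂ ξ₂ →
      ‖fderiv ℝ (fun ξ : E₁ => f₂₁ t ξ ξ₂) ξ₁‖ ≤ c₁)
    (hJ₂ : ∀ t : ℝ, 0 ≤ t → ∀ (ξ₁ : E₁) (ξ₂ : E₂), H₂ ξ₂ < 0 →
      ‖fderiv ℝ (fun ξ : E₁ => f₂₂ t ξ ξ₂) ξ₁‖ ≤ c₂) :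
    (∀ p : ℝ, 0 < p → IncrementallyExpStable (filippovField f₁₁ f₁₂ H₁) p →
      (p ≠ min q₁ q₂ →
        DrivenIncrementallyExpStable f₁₁ f₁₂ H₁ f₂₁ f₂₂ H₂ (min (min q₁ q₂) p)) ∧
      ∀ η : ℝ, 0 < η → η < min (min q₁ q₂) p →
        DrivenIncrementallyExpStable f₁₁ f₁₂ H₁ f₂₁ f₂₂ H₂ η) ∧
    (∀ p₁ p₂ : ℝ, 0 < p₁ → 0 < p₂ → ContractionConditions f₁₁ f₁₂ H₁ p₁ p₂ →
      (min p₁ p₂ ≠ min q₁ q₂ →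
        DrivenIncrementallyExpStable f₁₁ f₁₂ H₁ f₂₁ f₂₂ H₂
          (min (min q₁ q₂) (min p₁ p₂))) ∧
      ∀ η : ℝ, 0 < η → η < min (min q₁ q₂) (min p₁ p₂) →
        DrivenIncrementallyExpStable f₁₁ f₁₂ H₁ f₂₁ f₂₂ H₂ η) := by
  have h := theorem2_general f₁₁ f₁₂ H₁ f₂₁ f₂₂ H₂ hH₁ hH₂ hf₁₁ hf₁₂ hf₂₁ hf₂₂ q₁ q₂ c₁ c₂
    hII hJ₁ hJ₂
  exact ⟨fun p _ hI => (h.1 p hI).imp_right fun h η _ => h η,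
    fun p₁ p₂ _ _ hI => (h.2 p₁ p₂ hI).imp_right fun h η _ => h η⟩
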